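/- There is an absolute constant $K>0$ (independent of $N$ and of the matrices) such that the following holds for every $N$ and every unitary matrix $A\in U(N;\mathbb{C})$. Let $|A|^{\circ 2}\circ A$ be the $N\times N$ matrix with entries $|A_{i,k}|^2A_{i,k}$, let $U\Sigma V^{\mathsf H}$ be any singular value decomposition of $|A|^{\circ 2}\circ A$ ($U,V$ unitary, $\Sigma$ diagonal with non-negative real diagonal entries), and let $A'=UV^{\mathsf H}$; that is, $A'$ is the output of one iteration of the simplified MSP algorithm started at $A$. Let $C$ and $C'$ be the diagonal matrices with diagonal entries $C_{i,i}=e^{j\angle A_{i,i}}$ and $C'_{i,i}=e^{j\angle A'_{i,i}}$, where $\angle z$ is the argument of $z$ and $\angle 0=0$. Put $\epsilon=\|A-C\|_{\mathrm F}^2$, where $\|M\|_{\mathrm F}^2=\sum_{i,k}|M_{i,k}|^2$. If $\epsilon<0.394$, then $C$ and $C'$ are complex permutation matrices (unitary matrices with exactly one non-zero entry in every row and in every column), $$\|A'-C'\|_{\mathrm F}^2\le K\epsilon^3,$$ and, if moreover $\epsilon>0$, $$\|A'-C'\|_{\mathrm F}^2<\|A-C\|_{\mathrm F}^2 .$$ 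-/

import Mathlib

open scoped Matrix

/-- The Frobenius norm of a complex matrix. -/
noncomputable def frobeniusNorm {N : ℕ} (M : Matrix (Fin N) (Fin N) ℂ) : ℝ :=
  Real.sqrt (∑ i, ∑ k, ‖M i k‖ ^ 2)

/-- Complex permutation matrices: unitary matrices with exactly one non-zero entry in every row
and in every column. -/
def complexPermutations (N : ℕ) : Set (Matrix (Fin N) (Fin N) ℂ) :=
  {M | M ∈ Matrix.unitaryGroup (Fin N) ℂ ∧
    (∀ i, ∃! k, M i k ≠ 0) ∧ (∀ k, ∃! i, M i k ≠ 0)}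

/-- The entrywise cubic stretching `|A|^{∘2} ∘ A`. -/
noncomputable def stretch {N : ℕ} (A : Matrix (Fin N) (Fin N) ℂ) : Matrix (Fin N) (Fin N) ℂ :=
  (A.map fun z => ((‖z‖ : ℝ) : ℂ) ^ 2) ⊙ A

/-- `M = U Σ Vᴴ` is a singular value decomposition of `M`, where `Σ` is the diagonal matrix with
diagonal `σ`. No ordering of the singular values is imposed. -/
def IsSVD {N : ℕ} (M U : Matrix (Fin N) (Fin N) ℂ) (σ : Fin N → ℝ)
    (V : Matrix (Fin N) (Fin N) ℂ) : Prop :=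
  U ∈ Matrix.unitaryGroup (Fin N) ℂ ∧ V ∈ Matrix.unitaryGroup (Fin N) ℂ ∧ (∀ i, 0 ≤ σ i) ∧
    M = U * Matrix.diagonal (fun i => (σ i : ℂ)) * Vᴴ

/-- `A'` is an output of one iteration of the simplified MSP algorithm started at `A`:
`A' = U Vᴴ` for a singular value decomposition `U Σ Vᴴ` of `|A|^{∘2} ∘ A`. -/
def IsMSPStep {N : ℕ} (A A' : Matrix (Fin N) (Fin N) ℂ) : Prop :=
  ∃ (U : Matrix (Fin N) (Fin N) ℂ) (σ : Fin N → ℝ) (V : Matrix (Fin N) (Fin N) ℂ),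
    IsSVD (stretch A) U σ V ∧ A' = U * Vᴴ

/-- The diagonal phase matrix of `A`, with diagonal entries `e^{j∠A_{i,i}}`. -/
noncomputable def phaseDiag {N : ℕ} (A : Matrix (Fin N) (Fin N) ℂ) :
    Matrix (Fin N) (Fin N) ℂ :=
  Matrix.diagonal fun i => Complex.exp (Complex.I * (Complex.arg (A i i) : ℂ))

/-!
Write `C` for the phase matrix of `A`, and split the stretched matrix as `C * D + E`, where `D` is
the diagonal matrix with entries `|A i i| ^ 3` and `E` is the off-diagonal part. The iterate `A'` is
a unitary polar factor of this matrix, and `C` is the polar factor of `C * D`, so the claim is a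
perturbation bound for polar factors.

* If `M = Q * P` with `Q` unitary and `P` positive semidefinite, and `M = C * D + E`, then
  `Z = 1 - Qᴴ * C` solves the Sylvester equation `P * Z + Z * D = Qᴴ * E - Eᴴ * C`. Pairing it with
  `Z` bounds `‖Q - C‖ = ‖Z‖` by `2 ‖E‖ / d`, where `d` is a lower bound of `D`
  (`frobSq_polar_sub_le`).
* The off-diagonal mass `r i` of row `i` of `A` equals that of column `i`, so it is at most the sum
  of the other `r k`; since `∑ i, r i ≤ ε`, every `r i` is at most `ε / 2`
  (`two_mul_offDiag_row_le`). Hence the squared Frobenius norm of `E`, a sum of sixth powers, is at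
  most `ε ^ 3 / 4` (`frobSq_offDiag_stretch_le`), and the entries of `D` exceed `0.7` as soon as
  `ε < 0.394`.
* Among all diagonal unitary matrices, the phase matrix of `A'` is the closest one to `A'`
  (`frobSq_sub_phaseDiag_le`), so `‖A' - C'‖² ≤ ‖A' - C‖² ≤ ε ^ 3 / 0.49`.
-/

open scoped ComplexOrder

/-- The square of the Frobenius norm of a complex matrix. -/
noncomputable def frobSq {N : ℕ} (M : Matrix (Fin N) (Fin N) ℂ) : ℝ :=
  ∑ i, ∑ k, ‖M i k‖ ^ 2

variable {N : ℕ}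

/-! ### The squared Frobenius norm -/

theorem frobSq_nonneg (M : Matrix (Fin N) (Fin N) ℂ) : 0 ≤ frobSq M := by
  unfold frobSq; positivity

theorem frobeniusNorm_sq (M : Matrix (Fin N) (Fin N) ℂ) : frobeniusNorm M ^ 2 = frobSq M :=
  Real.sq_sqrt (frobSq_nonneg M)

theorem frobSq_conjTranspose (M : Matrix (Fin N) (Fin N) ℂ) : frobSq Mᴴ = frobSq M := by
  unfold frobSq
  rw [Finset.sum_comm]
  simp [Matrix.conjTranspose_apply]

theorem trace_conjTranspose_mul_self_eq_frobSq (M : Matrix (Fin N) (Fin N) ℂ) :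
    (Mᴴ * M).trace = (frobSq M : ℂ) := by
  unfold frobSq
  rw [Finset.sum_comm]
  simp [Matrix.trace, Matrix.mul_apply, Matrix.conjTranspose_apply, Complex.conj_mul']

theorem frobSq_unitary_mul {Q : Matrix (Fin N) (Fin N) ℂ} (hQ : Qᴴ * Q = 1)
    (M : Matrix (Fin N) (Fin N) ℂ) : frobSq (Q * M) = frobSq M := by
  have h : (Q * M)ᴴ * (Q * M) = Mᴴ * M := by
    rw [Matrix.conjTranspose_mul, Matrix.mul_assoc, ← Matrix.mul_assoc Qᴴ, hQ, Matrix.one_mul]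
  have := trace_conjTranspose_mul_self_eq_frobSq (Q * M)
  rw [h, trace_conjTranspose_mul_self_eq_frobSq] at this
  exact_mod_cast this.symm

theorem frobSq_mul_unitary {Q : Matrix (Fin N) (Fin N) ℂ} (hQ : Q * Qᴴ = 1)
    (M : Matrix (Fin N) (Fin N) ℂ) : frobSq (M * Q) = frobSq M := by
  rw [← frobSq_conjTranspose, Matrix.conjTranspose_mul, frobSq_unitary_mul (by simpa using hQ),
    frobSq_conjTranspose]

theorem frobSq_sub_le (X Y : Matrix (Fin N) (Fin N) ℂ) :
    frobSq (X - Y) ≤ 2 * frobSq X + 2 * frobSq Y := by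
  simp only [frobSq, Finset.mul_sum, ← Finset.sum_add_distrib]
  refine Finset.sum_le_sum fun i _ => Finset.sum_le_sum fun k _ => ?_
  have h := norm_sub_le (X i k) (Y i k)
  rw [Matrix.sub_apply]
  nlinarith [norm_nonneg (X i k - Y i k), sq_nonneg (‖X i k‖ - ‖Y i k‖)]

theorem two_mul_re_trace_conjTranspose_mul_le {d : ℝ} (hd : 0 < d)
    (Z W : Matrix (Fin N) (Fin N) ℂ) :
    2 * d * (Zᴴ * W).trace.re ≤ d ^ 2 * frobSq Z + frobSq W := by
  have h : (Zᴴ * W).trace.re = ∑ i, ∑ k, (star (Z i k) * W i k).re := by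
    rw [Finset.sum_comm]
    simp only [Matrix.trace, Matrix.diag_apply, Matrix.mul_apply, Matrix.conjTranspose_apply,
      Complex.re_sum]
  rw [h]
  simp only [frobSq, Finset.mul_sum, ← Finset.sum_add_distrib]
  refine Finset.sum_le_sum fun i _ => Finset.sum_le_sum fun k _ => ?_
  have h1 : (star (Z i k) * W i k).re ≤ ‖Z i k‖ * ‖W i k‖ := by
    refine (Complex.re_le_norm _).trans ?_
    rw [norm_mul, norm_star]
  nlinarith [sq_nonneg (d * ‖Z i k‖ - ‖W i k‖), mul_le_mul_of_nonneg_left h1 hd.le]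

theorem mul_frobSq_le_re_trace {d : ℝ} {δ : Fin N → ℝ} (hδ : ∀ i, d ≤ δ i)
    (Z : Matrix (Fin N) (Fin N) ℂ) :
    d * frobSq Z ≤ (Zᴴ * (Z * Matrix.diagonal fun i => (δ i : ℂ))).trace.re := by
  have h : (Zᴴ * (Z * Matrix.diagonal fun i => (δ i : ℂ))).trace.re
      = ∑ k, ∑ i, δ k * ‖Z i k‖ ^ 2 := by
    simp only [Matrix.trace, Matrix.diag_apply, Matrix.mul_apply (M := Zᴴ), Matrix.mul_diagonal,
      Matrix.conjTranspose_apply, Finset.sum_mul, Complex.re_sum, ← mul_assoc]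
    refine Finset.sum_congr rfl fun k _ => Finset.sum_congr rfl fun i _ => ?_
    rw [Complex.star_def, Complex.conj_mul']
    norm_cast
    ring
  rw [h, frobSq, Finset.sum_comm]
  simp only [Finset.mul_sum]
  exact Finset.sum_le_sum fun k _ => Finset.sum_le_sum fun i _ =>
    mul_le_mul_of_nonneg_right (hδ k) (sq_nonneg _)

/-! ### Perturbation of the polar factor -/

/-- If the polar factors of `Q * P` and `C * D` are `Q` and `C`, then `Q - C` is controlled by the
difference `E` of the two matrices. Only `D` has to be bounded below; `P` may be singular. -/
theorem frobSq_polar_sub_le {Q P C E : Matrix (Fin N) (Fin N) ℂ} {δ : Fin N → ℝ} {d : ℝ}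
    (hd : 0 < d) (hδ : ∀ i, d ≤ δ i) (hQ : Q ∈ Matrix.unitaryGroup (Fin N) ℂ)
    (hC : C ∈ Matrix.unitaryGroup (Fin N) ℂ) (hP : P.PosSemidef)
    (hM : Q * P = C * Matrix.diagonal (fun i => (δ i : ℂ)) + E) :
    d ^ 2 * frobSq (Q - C) ≤ 4 * frobSq E := by
  set D : Matrix (Fin N) (Fin N) ℂ := Matrix.diagonal fun i => (δ i : ℂ) with hD
  have hQ1 : Qᴴ * Q = 1 := Matrix.mem_unitaryGroup_iff'.1 hQ
  have hQ2 : Q * Qᴴ = 1 := Matrix.mem_unitaryGroup_iff.1 hQ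
  have hC1 : Cᴴ * C = 1 := Matrix.mem_unitaryGroup_iff'.1 hC
  have hC2 : C * Cᴴ = 1 := Matrix.mem_unitaryGroup_iff.1 hC
  have hDH : Dᴴ = D := by
    rw [hD, Matrix.diagonal_conjTranspose]
    congr 1
    funext i
    simp
  set Z := 1 - Qᴴ * C with hZ
  have hQZ : Q * Z = Q - C := by
    rw [hZ, Matrix.mul_sub, ← Matrix.mul_assoc, hQ2, Matrix.mul_one, Matrix.one_mul]
  have hPeq : P = Qᴴ * (C * D + E) := by
    rw [← hM, ← Matrix.mul_assoc, hQ1, Matrix.one_mul]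
  have hPQ : P * Qᴴ = D * Cᴴ + Eᴴ := by
    have h := congrArg Matrix.conjTranspose hM
    rwa [Matrix.conjTranspose_mul, Matrix.conjTranspose_add, Matrix.conjTranspose_mul, hDH,
      hP.isHermitian.eq] at h
  have hSyl : P * Z + Z * D = Qᴴ * E - Eᴴ * C := by
    have h1 : P * Z = P - (D + Eᴴ * C) := by
      rw [hZ, Matrix.mul_sub, Matrix.mul_one, ← Matrix.mul_assoc, hPQ, Matrix.add_mul,
        Matrix.mul_assoc D, hC1, Matrix.mul_one]
    rw [h1, hPeq, hZ, Matrix.sub_mul, Matrix.one_mul, Matrix.mul_add, Matrix.mul_assoc]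
    abel
  have hpos : 0 ≤ (Zᴴ * (P * Z)).trace.re := by
    rw [← Matrix.mul_assoc]
    exact (Complex.nonneg_iff.1 (hP.conjTranspose_mul_mul_same Z).trace_nonneg).1
  have hlow : d * frobSq Z ≤ (Zᴴ * (Qᴴ * E - Eᴴ * C)).trace.re := by
    rw [← hSyl, Matrix.mul_add, Matrix.trace_add, Complex.add_re]
    linarith [mul_frobSq_le_re_trace hδ Z]
  have hup := two_mul_re_trace_conjTranspose_mul_le hd Z (Qᴴ * E - Eᴴ * C)
  have hW := frobSq_sub_le (Qᴴ * E) (Eᴴ * C)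
  rw [frobSq_unitary_mul (by simpa using hQ2), frobSq_mul_unitary hC2, frobSq_conjTranspose] at hW
  rw [← hQZ, frobSq_unitary_mul hQ1]
  nlinarith [mul_le_mul_of_nonneg_left hlow hd.le]

/-! ### Diagonal phase matrices -/

theorem norm_exp_I_mul_arg (z : ℂ) : ‖Complex.exp (Complex.I * (Complex.arg z : ℂ))‖ = 1 := by
  rw [mul_comm, Complex.norm_exp_ofReal_mul_I]

theorem norm_mul_exp_I_mul_arg (z : ℂ) :
    (‖z‖ : ℂ) * Complex.exp (Complex.I * (Complex.arg z : ℂ)) = z := by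
  rw [mul_comm Complex.I, Complex.norm_mul_exp_arg_mul_I]

theorem phaseDiag_mem_unitaryGroup (A : Matrix (Fin N) (Fin N) ℂ) :
    phaseDiag A ∈ Matrix.unitaryGroup (Fin N) ℂ := by
  rw [Matrix.mem_unitaryGroup_iff, Matrix.star_eq_conjTranspose, phaseDiag,
    Matrix.diagonal_conjTranspose, Matrix.diagonal_mul_diagonal, ← Matrix.diagonal_one]
  congr 1
  funext i
  rw [Pi.star_apply, Complex.star_def, Complex.mul_conj', norm_exp_I_mul_arg]
  norm_num

theorem phaseDiag_mem_complexPermutations (A : Matrix (Fin N) (Fin N) ℂ) :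
    phaseDiag A ∈ complexPermutations N := by
  refine ⟨phaseDiag_mem_unitaryGroup A, fun i => ⟨i, ?_, fun k hk => ?_⟩,
    fun k => ⟨k, ?_, fun i hi => ?_⟩⟩
  · simp [phaseDiag]
  · by_contra h
    exact hk (Matrix.diagonal_apply_ne' _ h)
  · simp [phaseDiag]
  · by_contra h
    exact hi (Matrix.diagonal_apply_ne _ h)

/-- The phase matrix of `B` is a closest diagonal unitary matrix to `B`; here it is compared with
the phase matrix of another matrix. -/
theorem frobSq_sub_phaseDiag_le (A B : Matrix (Fin N) (Fin N) ℂ) :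
    frobSq (B - phaseDiag B) ≤ frobSq (B - phaseDiag A) := by
  refine Finset.sum_le_sum fun i _ => Finset.sum_le_sum fun k _ => ?_
  rcases eq_or_ne i k with rfl | h
  · simp only [phaseDiag, Matrix.sub_apply, Matrix.diagonal_apply_eq]
    have h1 : ‖B i i - Complex.exp (Complex.I * (Complex.arg (B i i) : ℂ))‖ = |‖B i i‖ - 1| := by
      nth_rw 1 [← norm_mul_exp_I_mul_arg (B i i)]
      rw [← sub_one_mul, norm_mul, norm_exp_I_mul_arg, mul_one]
      norm_cast
    rw [h1, ← norm_exp_I_mul_arg (A i i)]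
    gcongr
    exact abs_norm_sub_norm_le _ _
  · simp [phaseDiag, h]

/-! ### Off-diagonal mass of a unitary matrix -/

theorem sum_row_norm_sq {A : Matrix (Fin N) (Fin N) ℂ} (hA : A ∈ Matrix.unitaryGroup (Fin N) ℂ)
    (i : Fin N) : ∑ k, ‖A i k‖ ^ 2 = 1 := by
  have h := congrFun (congrFun (Matrix.mem_unitaryGroup_iff.1 hA) i) i
  simp only [Matrix.mul_apply, Matrix.star_apply, Complex.star_def, Complex.mul_conj',
    Matrix.one_apply_eq] at h
  exact_mod_cast h

theorem sum_col_norm_sq {A : Matrix (Fin N) (Fin N) ℂ} (hA : A ∈ Matrix.unitaryGroup (Fin N) ℂ)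
    (k : Fin N) : ∑ i, ‖A i k‖ ^ 2 = 1 := by
  have h := congrFun (congrFun (Matrix.mem_unitaryGroup_iff'.1 hA) k) k
  simp only [Matrix.mul_apply, Matrix.star_apply, Complex.star_def, Complex.conj_mul',
    Matrix.one_apply_eq] at h
  exact_mod_cast h

theorem offDiag_row_eq {A : Matrix (Fin N) (Fin N) ℂ} (hA : A ∈ Matrix.unitaryGroup (Fin N) ℂ)
    (i : Fin N) : ∑ k ∈ Finset.univ.erase i, ‖A i k‖ ^ 2 = 1 - ‖A i i‖ ^ 2 := by
  rw [← sum_row_norm_sq hA i, ← Finset.add_sum_erase _ _ (Finset.mem_univ i)]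
  ring

/-- Each off-diagonal entry of row `i` lies in another column, so the off-diagonal mass
`1 - ‖A i i‖ ^ 2` of that row is at most the sum of the off-diagonal masses of the other columns. -/
theorem two_mul_offDiag_row_le {A : Matrix (Fin N) (Fin N) ℂ}
    (hA : A ∈ Matrix.unitaryGroup (Fin N) ℂ) (i : Fin N) :
    2 * (1 - ‖A i i‖ ^ 2) ≤ ∑ k, (1 - ‖A k k‖ ^ 2) := by
  have h : 1 - ‖A i i‖ ^ 2 ≤ ∑ k ∈ Finset.univ.erase i, (1 - ‖A k k‖ ^ 2) := by
    rw [← offDiag_row_eq hA i]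
    refine Finset.sum_le_sum fun k hk => ?_
    have hik : i ∈ Finset.univ.erase k :=
      Finset.mem_erase.2 ⟨(Finset.ne_of_mem_erase hk).symm, Finset.mem_univ i⟩
    have h1 := Finset.single_le_sum (f := fun j => ‖A j k‖ ^ 2) (fun j _ => sq_nonneg _) hik
    have h2 := Finset.add_sum_erase Finset.univ (fun j => ‖A j k‖ ^ 2) (Finset.mem_univ k)
    rw [sum_col_norm_sq hA k] at h2
    linarith
  rw [← Finset.add_sum_erase _ _ (Finset.mem_univ i)]
  linarith

theorem sum_offDiag_le_frobSq {A : Matrix (Fin N) (Fin N) ℂ}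
    (hA : A ∈ Matrix.unitaryGroup (Fin N) ℂ) :
    ∑ i, (1 - ‖A i i‖ ^ 2) ≤ frobSq (A - phaseDiag A) := by
  refine Finset.sum_le_sum fun i _ => ?_
  rw [← offDiag_row_eq hA i]
  refine (Finset.sum_congr rfl fun k hk => ?_).trans_le
    (Finset.sum_le_sum_of_subset_of_nonneg (Finset.subset_univ (Finset.univ.erase i))
      fun k _ _ => sq_nonneg ‖(A - phaseDiag A) i k‖)
  simp [phaseDiag, (Finset.ne_of_mem_erase hk).symm]

/-- The diagonal of `stretch A` is the diagonal of `phaseDiag A`, scaled by `‖A i i‖ ^ 3`. -/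
theorem stretch_sub_phaseDiag_mul_apply (A : Matrix (Fin N) (Fin N) ℂ) (i k : Fin N) :
    (stretch A - phaseDiag A * Matrix.diagonal fun i => ((‖A i i‖ ^ 3 : ℝ) : ℂ)) i k =
      if i = k then 0 else (‖A i k‖ : ℂ) ^ 2 * A i k := by
  split_ifs with h
  · subst h
    simp only [stretch, phaseDiag, Matrix.sub_apply, Matrix.hadamard_apply, Matrix.map_apply,
      Matrix.diagonal_mul_diagonal, Matrix.diagonal_apply_eq]
    nth_rw 2 [← norm_mul_exp_I_mul_arg (A i i)]
    push_cast
    ring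
  · simp [stretch, phaseDiag, Matrix.diagonal_mul_diagonal, h]

theorem frobSq_offDiag_stretch_le {A : Matrix (Fin N) (Fin N) ℂ}
    (hA : A ∈ Matrix.unitaryGroup (Fin N) ℂ) :
    4 * frobSq (stretch A - phaseDiag A * Matrix.diagonal fun i => ((‖A i i‖ ^ 3 : ℝ) : ℂ)) ≤
      frobSq (A - phaseDiag A) ^ 3 := by
  set ε := frobSq (A - phaseDiag A) with hε
  have hsum := sum_offDiag_le_frobSq hA
  have hrow : ∀ i, ∑ k, ‖(stretch A - phaseDiag A *
      Matrix.diagonal fun i => ((‖A i i‖ ^ 3 : ℝ) : ℂ)) i k‖ ^ 2 ≤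
      (ε / 2) ^ 2 * (1 - ‖A i i‖ ^ 2) := by
    intro i
    rw [← Finset.add_sum_erase _ _ (Finset.mem_univ i), stretch_sub_phaseDiag_mul_apply, if_pos rfl,
      norm_zero, zero_pow two_ne_zero, zero_add, ← offDiag_row_eq hA i, Finset.mul_sum]
    refine Finset.sum_le_sum fun k hk => ?_
    rw [stretch_sub_phaseDiag_mul_apply, if_neg (Finset.ne_of_mem_erase hk).symm]
    have hx : ‖A i k‖ ^ 2 ≤ ε / 2 := by
      have h1 := Finset.single_le_sum (f := fun k => ‖A i k‖ ^ 2) (fun j _ => sq_nonneg _) hk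
      rw [offDiag_row_eq hA i] at h1
      linarith [two_mul_offDiag_row_le hA i]
    have h2 : ‖(‖A i k‖ : ℂ) ^ 2 * A i k‖ ^ 2 = (‖A i k‖ ^ 2) ^ 2 * ‖A i k‖ ^ 2 := by
      rw [norm_mul, norm_pow, Complex.norm_real, norm_norm]
      ring
    rw [h2]
    gcongr
  have htot := Finset.sum_le_sum fun i (_ : i ∈ Finset.univ) => hrow i
  rw [← Finset.mul_sum] at htot
  rw [frobSq]
  nlinarith [mul_le_mul_of_nonneg_left hsum (sq_nonneg (ε / 2))]

/-! ### One step of the iteration -/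

/-- An output of an MSP step is a unitary polar factor of the stretched matrix. -/
theorem IsMSPStep.exists_polar {A A' : Matrix (Fin N) (Fin N) ℂ} (h : IsMSPStep A A') :
    A' ∈ Matrix.unitaryGroup (Fin N) ℂ ∧
      ∃ P : Matrix (Fin N) (Fin N) ℂ, P.PosSemidef ∧ A' * P = stretch A := by
  obtain ⟨U, σ, V, ⟨hU, hV, hσ, hM⟩, rfl⟩ := h
  refine ⟨mul_mem hU (Unitary.star_mem hV), V * Matrix.diagonal (fun i => (σ i : ℂ)) * Vᴴ, ?_, ?_⟩
  · refine Matrix.PosSemidef.mul_mul_conjTranspose_same ?_ V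
    exact Matrix.PosSemidef.diagonal fun i => by simpa using hσ i
  · have hV1 : Vᴴ * V = 1 := Matrix.mem_unitaryGroup_iff'.1 hV
    rw [hM]
    simp only [Matrix.mul_assoc]
    rw [← Matrix.mul_assoc Vᴴ V, hV1, Matrix.one_mul]

theorem frobSq_mspStep_le {A A' : Matrix (Fin N) (Fin N) ℂ}
    (hA : A ∈ Matrix.unitaryGroup (Fin N) ℂ) (hstep : IsMSPStep A A')
    (hε : frobSq (A - phaseDiag A) < 0.394) :
    0.49 * frobSq (A' - phaseDiag A') ≤ frobSq (A - phaseDiag A) ^ 3 := by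
  obtain ⟨hA', P, hP, hM⟩ := hstep.exists_polar
  -- `‖A i i‖ ^ 2 ≥ 1 - ε / 2 > 0.803 > 0.896 ^ 2`, and `0.896 ^ 3 > 0.7`.
  have hδ : ∀ i, (0.7 : ℝ) ≤ ‖A i i‖ ^ 3 := by
    intro i
    have h1 : (0.803 : ℝ) ≤ ‖A i i‖ ^ 2 := by
      linarith [two_mul_offDiag_row_le hA i, sum_offDiag_le_frobSq hA]
    have h2 : (0.896 : ℝ) ≤ ‖A i i‖ :=
      le_of_sq_le_sq (by linarith) (norm_nonneg _)
    calc (0.7 : ℝ) ≤ 0.896 ^ 3 := by norm_num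
      _ ≤ ‖A i i‖ ^ 3 := by gcongr
  have h := frobSq_polar_sub_le (E := stretch A - phaseDiag A *
    Matrix.diagonal fun i => ((‖A i i‖ ^ 3 : ℝ) : ℂ)) (by norm_num) hδ hA'
    (phaseDiag_mem_unitaryGroup A) hP (by rw [hM]; abel)
  have h1 := frobSq_offDiag_stretch_le hA
  have h2 := frobSq_sub_phaseDiag_le A A'
  linarith

theorem lemma8 :
    ∃ K : ℝ, 0 < K ∧
      ∀ (N : ℕ) (A A' : Matrix (Fin N) (Fin N) ℂ) (ε : ℝ),
        A ∈ Matrix.unitaryGroup (Fin N) ℂ →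
        IsMSPStep A A' →
        frobeniusNorm (A - phaseDiag A) ^ 2 = ε →
        ε < 0.394 →
          phaseDiag A ∈ complexPermutations N ∧
          phaseDiag A' ∈ complexPermutations N ∧
          (0 < ε →
            frobeniusNorm (A' - phaseDiag A') ^ 2 < frobeniusNorm (A - phaseDiag A) ^ 2) ∧
          frobeniusNorm (A' - phaseDiag A') ^ 2 ≤ K * ε ^ 3 := by
  refine ⟨3, by norm_num, fun N A A' ε hA hstep hε hlt =>
    ⟨phaseDiag_mem_complexPermutations A, phaseDiag_mem_complexPermutations A', fun hpos => ?_, ?_⟩⟩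
  all_goals
    rw [frobeniusNorm_sq] at hε
    have h := frobSq_mspStep_le hA hstep (hε ▸ hlt)
    simp only [frobeniusNorm_sq]
    rw [hε] at h
  · rw [hε]
    -- `ε ^ 3 < 0.49 * ε`, because `0.394 ^ 2 < 0.49`.
    have h2 : ε ^ 2 < 0.49 := by nlinarith
    nlinarith [mul_lt_mul_of_pos_right h2 hpos]
  · have := frobSq_nonneg (A' - phaseDiag A')
    linarith
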